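/- A \emph{semiheap} is a set $X$ (possibly empty) with a ternary product $[\,\cdot,\cdot,\cdot\,]$ satisfying $$[[x_1,x_2,x_3],x_4,x_5]=[x_1,[x_4,x_3,x_2],x_5]=[x_1,x_2,[x_3,x_4,x_5]];$$ it is a \emph{heap} if moreover $[x,x,y]=[y,x,x]=y$ for all $x,y$. A \emph{Lie semiheap} (resp. \emph{Lie heap}) is a smooth manifold with a semiheap (resp. heap) structure whose ternary product is smooth. A \emph{supermanifold} of dimension $n|m$ is a Hausdorff second countable space $|M|$ with a sheaf $\mathcal O_M$ of supercommutative $\mathbb R$-superalgebras that is locally isomorphic to $\mathbb R^{n|m}=(\mathbb R^n, C^\infty_{\mathbb R^n}\otimes\Lambda(\xi^1,\dots,\xi^m))$; a morphism $\phi:M\to N$ is a continuous map $|\phi|:|M|\to|N|$ (the reduced map) together with even unital $\mathbb R$-algebra homomorphisms $\mathcal O_N(V)\to\mathcal O_M(|\phi|^{-1}V)$ compatible with restriction. The \emph{reduced manifold} of $M$ is $|M|$ with the atlas of maps underlying the local isomorphisms with $\mathbb R^{n|m}$. Write $M(T)=\mathrm{Hom}(T,M)$. A \emph{Lie supersemiheap}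 is a supermanifold $S$ with a semiheap structure $\mu_T$ on $S(T)$ for every supermanifold $T$, such that for every morphism $\psi:T'\to T$ the map $S(T)\to S(T')$, $f\mapsto f\circ\psi$, is a semiheap homomorphism; it is a \emph{Lie superheap} if all the $S(T)$ are heaps. \textbf{Proposition.} Let $S$ be a Lie supersemiheap. Then the reduced manifold $|S|$ is a smooth manifold, and there is a unique map $|\mu|:|S|\times|S|\times|S|\to|S|$ with $$|\mu_T(f,g,h)|(t)=|\mu|\big(|f|(t),|g|(t),|h|(t)\big)$$ for all supermanifolds $T$, all $f,g,h\in S(T)$ and all $t\in|T|$. For every product $S^{(3)}=S\times S\times S$ in the category of supermanifolds, with projections $p_1,p_2,p_3$, the map $(|p_1|,|p_2|,|p_3|):|S^{(3)}|\to|S|\times|S|\times|S|$ is a diffeomorphism, and under this identification $|\mu|$ is the reduced map of the morphism $\mu=\mu_{S^{(3)}}(p_1,p_2,p_3):S^{(3)}\to S$ that corresponds to $\mu_{-}$ by the Yoneda lemma. The map $|\mu|$ is smooth and makes $|S|$ a Lie semiheap. If $S$ is a Lie superheap, then $|\mu|$ makes $|S|$ a Lie heap. -/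

import Mathlib

open CategoryTheory TopologicalSpace Opposite AlgebraicGeometry
open scoped Manifold ContDiff TensorProduct

/-! ## Semiheaps and heaps -/

/-- A semiheap structure on a (possibly empty) type: a para-associative ternary product. -/
@[ext]
structure Semiheap (X : Type*) where
  /-- the ternary product `[x, y, z]` -/
  op : X → X → X → X
  para_assoc_left : ∀ x₁ x₂ x₃ x₄ x₅,
    op (op x₁ x₂ x₃) x₄ x₅ = op x₁ (op x₄ x₃ x₂) x₅
  para_assoc_right : ∀ x₁ x₂ x₃ x₄ x₅,
    op x₁ (op x₄ x₃ x₂) x₅ = op x₁ x₂ (op x₃ x₄ x₅)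

/-- A semiheap is a heap if `[x, x, y] = [y, x, x] = y`. -/
def Semiheap.IsHeap {X : Type*} (A : Semiheap X) : Prop :=
  ∀ x y, A.op x x y = y ∧ A.op y x x = y

/-- Semiheap homomorphisms. -/
def Semiheap.IsHom {X Y : Type*} (A : Semiheap X) (B : Semiheap Y) (φ : X → Y) : Prop :=
  ∀ x y z, φ (A.op x y z) = B.op (φ x) (φ y) (φ z)

/-- A semiheap structure on a charted space modelled on `ℝⁿ` is a Lie semiheap if the space is a
(Hausdorff, second countable) smooth manifold and the ternary product is smooth. -/
structure IsLieSemiheap (n : ℕ) {X : Type*} [TopologicalSpace X]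
    [ChartedSpace (EuclideanSpace ℝ (Fin n)) X] (A : Semiheap X) : Prop where
  t2 : T2Space X
  secondCountable : SecondCountableTopology X
  isManifold : IsManifold (𝓡 n) ∞ X
  smooth : ContMDiff ((𝓡 n).prod ((𝓡 n).prod (𝓡 n))) (𝓡 n) ∞
    (fun p : X × X × X => A.op p.1 p.2.1 p.2.2)

/-- A Lie heap is a Lie semiheap whose underlying semiheap is a heap. -/
structure IsLieHeap (n : ℕ) {X : Type*} [TopologicalSpace X]
    [ChartedSpace (EuclideanSpace ℝ (Fin n)) X] (A : Semiheap X) : Prop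
    extends IsLieSemiheap n A where
  isHeap : A.IsHeap

/-! ## Superringed spaces -/

/-- A superringed space (over `ℝ`): a topological space with a sheaf of unital associative
`ℝ`-algebras whose sections are `ℤ/2`-graded compatibly with restriction, and supercommutative. -/
structure SuperringedSpace extends SheafedSpace (AlgCat.{0} ℝ) where
  /-- the even (`0`) and the odd (`1`) sections over an open set -/
  grading : ∀ U : (Opens carrier)ᵒᵖ, ZMod 2 → Submodule ℝ (presheaf.obj U)
  gradedAlgebra : ∀ U, GradedAlgebra (grading U)
  map_mem : ∀ {U V : (Opens carrier)ᵒᵖ} (r : U ⟶ V) (i : ZMod 2) (a : presheaf.obj U),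
    a ∈ grading U i → (presheaf.map r).hom a ∈ grading V i
  supercomm : ∀ (U : (Opens carrier)ᵒᵖ) (i j : ZMod 2) (a b : presheaf.obj U),
    a ∈ grading U i → b ∈ grading U j → a * b = (-1) ^ (i.val * j.val) * (b * a)

namespace SuperringedSpace

/-- Morphisms of superringed spaces: a continuous map together with a family of grading preserving
unital algebra homomorphisms `𝒪_Y(V) → 𝒪_X(φ⁻¹ V)` compatible with restriction. -/
@[ext]
structure Hom (X Y : SuperringedSpace) where
  toHom : X.toPresheafedSpace ⟶ Y.toPresheafedSpace
  map_mem : ∀ (U : (Opens Y.carrier)ᵒᵖ) (i : ZMod 2) (a : Y.presheaf.obj U),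
    a ∈ Y.grading U i →
      (toHom.c.app U).hom a ∈ X.grading (op ((Opens.map toHom.base).obj U.unop)) i

instance : Category SuperringedSpace where
  Hom := Hom
  id _ := ⟨𝟙 _, fun _ _ _ h => h⟩
  comp f g := ⟨f.toHom ≫ g.toHom, fun U i a h =>
    f.map_mem (op ((Opens.map g.toHom.base).obj U.unop)) i _ (g.map_mem U i a h)⟩
  id_comp f := Hom.ext (Category.id_comp f.toHom)
  comp_id f := Hom.ext (Category.comp_id f.toHom)
  assoc f g h := Hom.ext (Category.assoc f.toHom g.toHom h.toHom)

end SuperringedSpace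

/-! ## The local model `ℝ^{n|m}` -/

namespace SuperDomain

/-- The sections `C^∞(W) ⊗ Λ(ξ¹, …, ξᵐ)` of the structure sheaf of `ℝ^{n|m}` over `W ⊆ ℝⁿ`. -/
abbrev Sections (n m : ℕ) (W : Opens (EuclideanSpace ℝ (Fin n))) : Type :=
  C^∞⟮𝓡 n, W; 𝓘(ℝ, ℝ), ℝ⟯ ⊗[ℝ] ExteriorAlgebra ℝ (Fin m → ℝ)

/-- Restriction of smooth functions, as an algebra homomorphism. -/
noncomputable def restrictFun {n : ℕ} {W W' : Opens (EuclideanSpace ℝ (Fin n))} (h : W' ≤ W) :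
    C^∞⟮𝓡 n, W; 𝓘(ℝ, ℝ), ℝ⟯ →ₐ[ℝ] C^∞⟮𝓡 n, W'; 𝓘(ℝ, ℝ), ℝ⟯ :=
  { ContMDiffMap.restrictRingHom (𝓡 n) 𝓘(ℝ, ℝ) ℝ h with commutes' := fun _ => rfl }

/-- Restriction of sections of the structure sheaf of `ℝ^{n|m}`. -/
noncomputable def restrict {n : ℕ} (m : ℕ) {W W' : Opens (EuclideanSpace ℝ (Fin n))}
    (h : W' ≤ W) : Sections n m W →ₐ[ℝ] Sections n m W' :=
  Algebra.TensorProduct.map (restrictFun h) (AlgHom.id ℝ _)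

/-- The grading of `C^∞(W) ⊗ Λ(ξ¹, …, ξᵐ)`: smooth functions are even, every `ξʲ` is odd. -/
noncomputable def grading (n m : ℕ) (W : Opens (EuclideanSpace ℝ (Fin n))) (i : ZMod 2) :
    Submodule ℝ (Sections n m W) :=
  LinearMap.range (LinearMap.lTensor C^∞⟮𝓡 n, W; 𝓘(ℝ, ℝ), ℝ⟯
    (CliffordAlgebra.evenOdd (0 : QuadraticForm ℝ (Fin m → ℝ)) i).subtype)

end SuperDomain

/-! ## Supermanifolds -/

/-- The open subset of the source of `e` that corresponds to the open set `W` of the model. -/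
def OpenPartialHomeomorph.preimageOpens {X E : Type*} [TopologicalSpace X] [TopologicalSpace E]
    (e : OpenPartialHomeomorph X E) (W : Opens E) : Opens X :=
  ⟨e.source ∩ e ⁻¹' W, e.isOpen_inter_preimage W.2⟩

theorem OpenPartialHomeomorph.preimageOpens_mono {X E : Type*} [TopologicalSpace X]
    [TopologicalSpace E] (e : OpenPartialHomeomorph X E) {W W' : Opens E} (h : W' ≤ W) :
    e.preimageOpens W' ≤ e.preimageOpens W :=
  fun _ hx => ⟨hx.1, h hx.2⟩

/-- A superchart: an isomorphism of superringed spaces between the restriction of `X` to the open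
set `source` and the restriction of `ℝ^{n|m}` to the open set `target`, that is, a homeomorphism
`source ≃ target` together with grading preserving algebra isomorphisms between the sections over
corresponding open sets, compatible with restriction. -/
structure SuperChart (X : SuperringedSpace) (n m : ℕ) where
  chart : OpenPartialHomeomorph X.carrier (EuclideanSpace ℝ (Fin n))
  iso : ∀ W : Opens (EuclideanSpace ℝ (Fin n)), (W : Set _) ⊆ chart.target →
    (X.presheaf.obj (op (chart.preimageOpens W)) ≃ₐ[ℝ] SuperDomain.Sections n m W)
  iso_mem : ∀ (W : Opens (EuclideanSpace ℝ (Fin n))) (hW : (W : Set _) ⊆ chart.target)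
    (i : ZMod 2) (a : X.presheaf.obj (op (chart.preimageOpens W))),
    iso W hW a ∈ SuperDomain.grading n m W i ↔ a ∈ X.grading (op (chart.preimageOpens W)) i
  iso_restrict : ∀ (W W' : Opens (EuclideanSpace ℝ (Fin n))) (h : W' ≤ W)
    (hW : (W : Set _) ⊆ chart.target) (hW' : (W' : Set _) ⊆ chart.target)
    (a : X.presheaf.obj (op (chart.preimageOpens W))),
    iso W' hW' ((X.presheaf.map (homOfLE (chart.preimageOpens_mono h)).op).hom a) =
      SuperDomain.restrict m h (iso W hW a)

/-- A supermanifold of dimension `evenDim|oddDim`: a superringed space over a Hausdorff second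
countable space that is locally isomorphic to `ℝ^{evenDim|oddDim}`. -/
structure Supermanifold extends SuperringedSpace where
  evenDim : ℕ
  oddDim : ℕ
  t2 : T2Space carrier
  secondCountable : SecondCountableTopology carrier
  exists_chart : ∀ x : carrier,
    ∃ c : SuperChart toSuperringedSpace evenDim oddDim, x ∈ c.chart.source

namespace Supermanifold

/-- The category of supermanifolds (of all dimensions); its morphisms are all morphisms of
superringed spaces, and `T ⟶ M` is the set `M(T)` of `T`-points of `M`. -/
instance : Category Supermanifold where
  Hom M N := M.toSuperringedSpace ⟶ N.toSuperringedSpace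
  id M := 𝟙 M.toSuperringedSpace
  comp {M N P} f g :=
    CategoryStruct.comp (X := M.toSuperringedSpace) (Y := N.toSuperringedSpace)
      (Z := P.toSuperringedSpace) f g
  id_comp {M N} f :=
    Category.id_comp (X := M.toSuperringedSpace) (Y := N.toSuperringedSpace) f
  comp_id {M N} f :=
    Category.comp_id (X := M.toSuperringedSpace) (Y := N.toSuperringedSpace) f
  assoc {M N P Q} f g h :=
    Category.assoc (W := M.toSuperringedSpace) (X := N.toSuperringedSpace)
      (Y := P.toSuperringedSpace) (Z := Q.toSuperringedSpace) f g h

/-- The reduced manifold `|M|`. -/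
def Reduced (M : Supermanifold) : Type := M.carrier

instance (M : Supermanifold) : TopologicalSpace M.Reduced :=
  inferInstanceAs (TopologicalSpace M.carrier)

/-- The atlas of the reduced manifold consists of the homeomorphisms underlying the supercharts. -/
noncomputable instance (M : Supermanifold) :
    ChartedSpace (EuclideanSpace ℝ (Fin M.evenDim)) M.Reduced where
  atlas := Set.range fun c : SuperChart M.toSuperringedSpace M.evenDim M.oddDim => c.chart
  chartAt x := (M.exists_chart x).choose.chart
  mem_chart_source x := (M.exists_chart x).choose_spec
  chart_mem_atlas _ := ⟨_, rfl⟩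

/-- The reduced map `|φ| : |M| → |N|` of a morphism of supermanifolds. -/
def reducedMap {M N : Supermanifold} (φ : M ⟶ N) : M.Reduced → N.Reduced :=
  fun x => (SuperringedSpace.Hom.toHom φ).base x

end Supermanifold

/-! ## Lie supersemiheaps -/

/-- The structure of a Lie supersemiheap on `S`: a semiheap structure on the `T`-points of `S` for
every supermanifold `T`, such that every `ψ : T' ⟶ T` induces a semiheap homomorphism. -/
structure LieSupersemiheap (S : Supermanifold) where
  points : ∀ T : Supermanifold, Semiheap (T ⟶ S)
  isHom : ∀ {T' T : Supermanifold} (ψ : T' ⟶ T),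
    (points T).IsHom (points T') (fun f => ψ ≫ f)

namespace LieSupersemiheap

variable {S : Supermanifold}

/-- A Lie superheap is a Lie supersemiheap all of whose semiheaps of `T`-points are heaps. -/
def IsSuperheap (A : LieSupersemiheap S) : Prop :=
  ∀ T, (A.points T).IsHeap

/-- The morphism `μ : S⁽³⁾ ⟶ S` that corresponds by the Yoneda lemma to the natural transformation
`μ_T : S⁽³⁾(T) → S(T)`, for a product `c` of three copies of `S` in supermanifolds (it is the value
of `μ` on the universal point, the triple of projections). -/
def mul (A : LieSupersemiheap S) (c : Limits.Fan fun _ : Fin 3 => S) : c.pt ⟶ S :=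
  (A.points c.pt).op (c.proj 0) (c.proj 1) (c.proj 2)

/-- The map of the reduced manifolds `|S⁽³⁾| → |S| × |S| × |S|` given by the projections. -/
def reducedProj (c : Limits.Fan fun _ : Fin 3 => S) (p : c.pt.Reduced) :
    S.Reduced × S.Reduced × S.Reduced :=
  (Supermanifold.reducedMap (c.proj 0) p, Supermanifold.reducedMap (c.proj 1) p,
    Supermanifold.reducedMap (c.proj 2) p)

/-- `ρ` is the reduced map of the natural transformation `μ`: on the points underlying arbitrary
`T`-points, the product `μ_T` induces `ρ`. -/
def IsReducedMap (A : LieSupersemiheap S)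
    (ρ : S.Reduced → S.Reduced → S.Reduced → S.Reduced) : Prop :=
  ∀ (T : Supermanifold) (f g h : T ⟶ S) (t : T.Reduced),
    Supermanifold.reducedMap ((A.points T).op f g h) t =
      ρ (Supermanifold.reducedMap f t) (Supermanifold.reducedMap g t)
        (Supermanifold.reducedMap h t)

end LieSupersemiheap

/-! A point of a supermanifold is seen through characters. Real characters kill nilpotents, and a
compatible family of characters over the neighbourhoods of a point must be evaluation of underlying
functions there (`SuperDomain.character_eq_eval`). So each point carries exactly one character, and
a morphism carries the character of `x` to that of its image. Pulling back the coordinate functions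
of a chart then shows that reduced maps are smooth (`contDiffAt_reducedMap`). Applied to the
identity, this makes the transition maps smooth.

Uniqueness of characters also identifies morphisms `ℝ^{k|0} ⟶ N` with smooth maps `ℝᵏ → |N|`
(`ofContMDiff`, `hom_ext_of_toFun_eq`). For `k = 0` these are the points of `|N|`. The semiheap of
`ℝ^{0|0}`-points therefore lives on `|S|`, so its identities are inherited, and naturality along
`ℝ^{0|0} ⟶ T` shows that it underlies every `μ_T`.

For general `k` they are smooth families. The product of three families is again the reduced map of
a morphism, hence smooth, and smoothness on `|S|³` can be tested on families
(`contMDiff_of_families`). No product `S⁽³⁾` is needed for this. When one exists, the same test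
applied to lifts into it shows that the inverse of the reduced projections is smooth. -/

/-! ## Values of sections of the local model -/

namespace SuperDomain

variable {n m : ℕ}

/-- Evaluation of smooth functions at a point. -/
noncomputable def evalFun {W : Opens (EuclideanSpace ℝ (Fin n))} (w : W) :
    C^∞⟮𝓡 n, W; 𝓘(ℝ, ℝ), ℝ⟯ →ₐ[ℝ] ℝ where
  toFun f := f w
  map_one' := rfl
  map_mul' _ _ := rfl
  map_zero' := rfl
  map_add' _ _ := rfl
  commutes' _ := rfl

/-- The smooth function underlying a section of the structure sheaf of `ℝ^{n|m}`. -/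
noncomputable def body (W : Opens (EuclideanSpace ℝ (Fin n))) :
    Sections n m W →ₐ[ℝ] C^∞⟮𝓡 n, W; 𝓘(ℝ, ℝ), ℝ⟯ :=
  Algebra.TensorProduct.productMap (AlgHom.id ℝ _)
    ((Algebra.ofId ℝ _).comp ExteriorAlgebra.algebraMapInv)

theorem body_tmul {W : Opens (EuclideanSpace ℝ (Fin n))} (f : C^∞⟮𝓡 n, W; 𝓘(ℝ, ℝ), ℝ⟯)
    (η : ExteriorAlgebra ℝ (Fin m → ℝ)) :
    body W (f ⊗ₜ[ℝ] η) = f * algebraMap ℝ _ (ExteriorAlgebra.algebraMapInv η) :=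
  rfl

theorem body_restrict {W W' : Opens (EuclideanSpace ℝ (Fin n))} (h : W' ≤ W)
    (a : Sections n m W) : body W' (restrict m h a) = restrictFun h (body W a) := by
  have : (body W').comp (restrict m h) = (restrictFun h).comp (body W) := by
    apply Algebra.TensorProduct.ext'
    intro f η
    simp only [AlgHom.comp_apply, restrict, Algebra.TensorProduct.map_tmul, body_tmul, map_mul,
      AlgHom.coe_id, id_eq, AlgHom.commutes]
  exact DFunLike.congr_fun this a

/-- A real character of the algebra of sections factors through the underlying functions, since
it kills the nilpotent generators. -/
theorem character_eq_comp_body {W : Opens (EuclideanSpace ℝ (Fin n))}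
    (φ : Sections n m W →ₐ[ℝ] ℝ) :
    φ = (φ.comp Algebra.TensorProduct.includeLeft).comp (body W) := by
  have hΛ : φ.comp Algebra.TensorProduct.includeRight = ExteriorAlgebra.algebraMapInv := by
    apply ExteriorAlgebra.hom_ext
    ext1 i
    ext
    set v := (LinearMap.single ℝ (fun _ : Fin m => ℝ) i) 1
    have h2 : (φ.comp Algebra.TensorProduct.includeRight) (ExteriorAlgebra.ι ℝ v) *
        (φ.comp Algebra.TensorProduct.includeRight) (ExteriorAlgebra.ι ℝ v) = 0 := by
      rw [← map_mul, ExteriorAlgebra.ι_sq_zero, map_zero]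
    have h3 := mul_self_eq_zero.mp h2
    simpa [ExteriorAlgebra.algebraMapInv, v] using h3
  apply Algebra.TensorProduct.ext'
  intro f η
  have h1 : φ ((1 : C^∞⟮𝓡 n, W; 𝓘(ℝ, ℝ), ℝ⟯) ⊗ₜ[ℝ] η) = ExteriorAlgebra.algebraMapInv η :=
    DFunLike.congr_fun hΛ η
  have h2 : f ⊗ₜ[ℝ] η = (f ⊗ₜ[ℝ] (1 : ExteriorAlgebra ℝ (Fin m → ℝ))) *
      ((1 : C^∞⟮𝓡 n, W; 𝓘(ℝ, ℝ), ℝ⟯) ⊗ₜ[ℝ] η) := by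
    rw [Algebra.TensorProduct.tmul_mul_tmul, mul_one, one_mul]
  rw [AlgHom.comp_apply, body_tmul, map_mul, AlgHom.commutes, h2, map_mul, h1]
  rfl

/-- The open subset of `W` on which a smooth function on `W` does not vanish. -/
def nonvanishing {W : Opens (EuclideanSpace ℝ (Fin n))} (g : C^∞⟮𝓡 n, W; 𝓘(ℝ, ℝ), ℝ⟯) :
    Opens (EuclideanSpace ℝ (Fin n)) :=
  ⟨Subtype.val '' {w : W | g w ≠ 0},
    W.2.isOpenMap_subtype_val _ (isOpen_ne_fun g.contMDiff.continuous continuous_const)⟩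

theorem nonvanishing_le {W : Opens (EuclideanSpace ℝ (Fin n))}
    (g : C^∞⟮𝓡 n, W; 𝓘(ℝ, ℝ), ℝ⟯) : nonvanishing g ≤ W := by
  rintro _ ⟨w, _, rfl⟩
  exact w.2

theorem isUnit_restrictFun_nonvanishing {W : Opens (EuclideanSpace ℝ (Fin n))}
    (g : C^∞⟮𝓡 n, W; 𝓘(ℝ, ℝ), ℝ⟯) : IsUnit (restrictFun (nonvanishing_le g) g) := by
  have hne : ∀ w, restrictFun (nonvanishing_le g) g w ≠ 0 := by
    rintro ⟨_, w, hw, rfl⟩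
    exact hw
  refine IsUnit.of_mul_eq_one
    (⟨fun w => (restrictFun (nonvanishing_le g) g w)⁻¹, ?_⟩ : C^∞⟮𝓡 n, _; 𝓘(ℝ, ℝ), ℝ⟯) ?_
  · exact (restrictFun (nonvanishing_le g) g).contMDiff.inv₀ hne
  · ext w
    exact mul_inv_cancel₀ (hne w)

/-- A family of real characters of the algebras of sections over the open neighbourhoods of a
point (contained in some given open set), compatible with restriction, is evaluation at the
point. -/
theorem character_eq_eval {O : Set (EuclideanSpace ℝ (Fin n))} {w : EuclideanSpace ℝ (Fin n)}
    (φ : ∀ W : Opens (EuclideanSpace ℝ (Fin n)), (W : Set _) ⊆ O → w ∈ W →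
      (Sections n m W →ₐ[ℝ] ℝ))
    (hφ : ∀ (W W' : Opens (EuclideanSpace ℝ (Fin n))) (h : W' ≤ W)
      (hW : (W : Set _) ⊆ O) (hW' : (W' : Set _) ⊆ O) (hw : w ∈ W')
      (a : Sections n m W), φ W' hW' hw (restrict m h a) = φ W hW (h hw) a)
    (W : Opens (EuclideanSpace ℝ (Fin n))) (hW : (W : Set _) ⊆ O) (hw : w ∈ W)
    (a : Sections n m W) : φ W hW hw a = body W a ⟨w, hw⟩ := by
  rw [character_eq_comp_body (φ W hW hw), AlgHom.comp_apply]
  set f := body W a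
  set ψ := (φ W hW hw).comp Algebra.TensorProduct.includeLeft with hψ
  by_contra hne
  -- Subtracting the value of the character gives `g` in its kernel with `g w ≠ 0`. On the locus
  -- where `g` is nonzero it becomes a unit, which no character kills. This contradicts
  -- compatibility with restriction.
  set g : C^∞⟮𝓡 n, W; 𝓘(ℝ, ℝ), ℝ⟯ := f - algebraMap ℝ _ (ψ f) with hg
  have hgw : g ⟨w, hw⟩ ≠ 0 := sub_ne_zero.mpr (Ne.symm hne)
  have hw' : w ∈ nonvanishing g := ⟨⟨w, hw⟩, hgw, rfl⟩
  have hψg : ψ g = 0 := by rw [hg, map_sub, AlgHom.commutes]; exact sub_self _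
  have hunit := (isUnit_restrictFun_nonvanishing g).map
    ((φ _ (Set.Subset.trans (nonvanishing_le g) hW) hw').comp Algebra.TensorProduct.includeLeft)
  refine hunit.ne_zero ?_
  have := hφ W _ (nonvanishing_le g) hW (Set.Subset.trans (nonvanishing_le g) hW) hw' (g ⊗ₜ 1)
  rw [restrict, Algebra.TensorProduct.map_tmul, map_one] at this
  exact this.trans hψg

end SuperDomain

/-! ## Points of supermanifolds -/

/-- A real character of the stalk of the structure sheaf at `x`: characters of the algebras of
sections over the open neighbourhoods of `x`, compatible with restriction. -/
@[ext]
structure PointCharacter (X : SuperringedSpace) (x : X.carrier) where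
  hom : ∀ U : Opens X.carrier, x ∈ U → (X.presheaf.obj (op U) →ₐ[ℝ] ℝ)
  hom_map : ∀ (U V : Opens X.carrier) (r : op U ⟶ op V) (hV : x ∈ V) (hU : x ∈ U)
    (a : X.presheaf.obj (op U)), hom V hV ((X.presheaf.map r).hom a) = hom U hU a

namespace PointCharacter

variable {X Y : SuperringedSpace}

/-- Odd sections are nilpotent, so they vanish at every point. -/
theorem hom_eq_zero_of_mem_grading_one {x : X.carrier} (φ : PointCharacter X x)
    {U : Opens X.carrier} (hU : x ∈ U) {a : X.presheaf.obj (op U)}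
    (ha : a ∈ X.grading (op U) 1) : φ.hom U hU a = 0 := by
  have h := congrArg (φ.hom U hU) (X.supercomm (op U) 1 1 a a ha ha)
  have h1 : (1 : ZMod 2).val * (1 : ZMod 2).val = 1 := by decide
  rw [h1, pow_one, neg_one_mul, map_neg, map_mul] at h
  exact mul_self_eq_zero.mp (self_eq_neg.mp h)

/-- The image of a character under a morphism. -/
noncomputable def map (f : X ⟶ Y) {x : X.carrier} (φ : PointCharacter X x) :
    PointCharacter Y (f.toHom.base x) where
  hom U hU := (φ.hom ((Opens.map f.toHom.base).obj U) hU).comp (f.toHom.c.app (op U)).hom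
  hom_map U V r hV hU a := by
    have h := congrArg (fun t => t.hom a) (f.toHom.c.naturality r)
    have h' := φ.hom_map _ _ ((Opens.map f.toHom.base).op.map r) hV hU
      ((f.toHom.c.app (op U)).hom a)
    rw [AlgHom.comp_apply, AlgHom.comp_apply, ← h']
    exact congrArg _ h

end PointCharacter

namespace SuperChart

variable {X : SuperringedSpace} {n m : ℕ} (c : SuperChart X n m)

/-- The open subset of the target of a chart that corresponds to an open subset of `X`. -/
def imageOpens (U : Opens X.carrier) : Opens (EuclideanSpace ℝ (Fin n)) :=
  c.chart.symm.preimageOpens U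

theorem imageOpens_subset (U : Opens X.carrier) : (c.imageOpens U : Set _) ⊆ c.chart.target :=
  fun _ h => h.1

theorem preimageOpens_imageOpens_le (U : Opens X.carrier) :
    c.chart.preimageOpens (c.imageOpens U) ≤ U := fun x hx => by
  have := hx.2.2
  simpa [c.chart.left_inv hx.1] using this

theorem mem_imageOpens {U : Opens X.carrier} {x : X.carrier} (hx : x ∈ c.chart.source)
    (hU : x ∈ U) : c.chart x ∈ c.imageOpens U :=
  ⟨c.chart.map_source hx, by
    change c.chart.symm (c.chart x) ∈ U
    rwa [c.chart.left_inv hx]⟩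

theorem mem_preimageOpens {W : Opens (EuclideanSpace ℝ (Fin n))} {x : X.carrier}
    (hx : x ∈ c.chart.source) (hW : c.chart x ∈ W) : x ∈ c.chart.preimageOpens W :=
  ⟨hx, hW⟩

/-- The smooth function on the target of a chart underlying a section. -/
noncomputable def bodyFun (U : Opens X.carrier) (a : X.presheaf.obj (op U)) :
    C^∞⟮𝓡 n, c.imageOpens U; 𝓘(ℝ, ℝ), ℝ⟯ :=
  SuperDomain.body _ (c.iso (c.imageOpens U) (c.imageOpens_subset U)
    ((X.presheaf.map (homOfLE (c.preimageOpens_imageOpens_le U)).op).hom a))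

/-- Transported through the chart, the character becomes a compatible family on the model, where
`SuperDomain.character_eq_eval` applies. -/
theorem hom_iso_symm {x : X.carrier} (hx : x ∈ c.chart.source) (φ : PointCharacter X x)
    {W : Opens (EuclideanSpace ℝ (Fin n))} (hW : (W : Set _) ⊆ c.chart.target)
    (hxW : c.chart x ∈ W) (s : SuperDomain.Sections n m W) :
    φ.hom (c.chart.preimageOpens W) (c.mem_preimageOpens hx hxW) ((c.iso W hW).symm s) =
      SuperDomain.body W s ⟨c.chart x, hxW⟩ := by
  refine SuperDomain.character_eq_eval (O := c.chart.target) (w := c.chart x)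
    (fun W hW hw => (φ.hom (c.chart.preimageOpens W) (c.mem_preimageOpens hx hw)).comp
      (c.iso W hW).symm.toAlgHom) ?_ W hW hxW s
  intro W W' h hW hW' hw s
  have h1 : (c.iso W' hW').symm (SuperDomain.restrict m h s) =
      (X.presheaf.map (homOfLE (c.chart.preimageOpens_mono h)).op).hom ((c.iso W hW).symm s) := by
    rw [AlgEquiv.symm_apply_eq, c.iso_restrict W W' h hW hW', AlgEquiv.apply_symm_apply]
  exact (congrArg _ h1).trans (φ.hom_map _ _ _ _ _ _)

/-- Every character at a point is evaluation of the underlying function. -/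
theorem hom_eq_bodyFun {x : X.carrier} (hx : x ∈ c.chart.source) (φ : PointCharacter X x)
    {U : Opens X.carrier} (hU : x ∈ U) (a : X.presheaf.obj (op U)) :
    φ.hom U hU a = c.bodyFun U a ⟨c.chart x, c.mem_imageOpens hx hU⟩ := by
  rw [← φ.hom_map U _ (homOfLE (c.preimageOpens_imageOpens_le U)).op
    (c.mem_preimageOpens hx (c.mem_imageOpens hx hU)) hU, bodyFun,
    ← c.hom_iso_symm hx φ (c.imageOpens_subset U), AlgEquiv.symm_apply_apply]

/-- The character given by evaluation of underlying functions in a chart. -/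
noncomputable def character {x : X.carrier} (hx : x ∈ c.chart.source) : PointCharacter X x where
  hom U hU := (SuperDomain.evalFun ⟨c.chart x, c.mem_imageOpens hx hU⟩).comp
    ((SuperDomain.body _).comp ((c.iso (c.imageOpens U) (c.imageOpens_subset U)).toAlgHom.comp
      (X.presheaf.map (homOfLE (c.preimageOpens_imageOpens_le U)).op).hom))
  hom_map U V r hV hU a := by
    have hle : c.imageOpens V ≤ c.imageOpens U := fun w hw => ⟨hw.1, leOfHom r.unop hw.2⟩
    -- Both sides are the restriction from `U` to the chart domain of `V`, factored in two ways.
    have h1 : (X.presheaf.map (homOfLE (c.preimageOpens_imageOpens_le V)).op).hom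
        ((X.presheaf.map r).hom a) =
        (X.presheaf.map (homOfLE (c.chart.preimageOpens_mono hle)).op).hom
          ((X.presheaf.map (homOfLE (c.preimageOpens_imageOpens_le U)).op).hom a) := by
      have := X.presheaf.map_comp r (homOfLE (c.preimageOpens_imageOpens_le V)).op
      have h' := X.presheaf.map_comp (homOfLE (c.preimageOpens_imageOpens_le U)).op
        (homOfLE (c.chart.preimageOpens_mono hle)).op
      exact congrArg (fun t => t.hom a) (this.symm.trans h')
    have h2 := congrArg (SuperDomain.body (c.imageOpens V)) (c.iso_restrict _ _ hle
      (c.imageOpens_subset U) (c.imageOpens_subset V)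
      ((X.presheaf.map (homOfLE (c.preimageOpens_imageOpens_le U)).op).hom a))
    rw [SuperDomain.body_restrict, ← h1] at h2
    exact congrArg (fun f => f ⟨c.chart x, c.mem_imageOpens hx hV⟩) h2

/-- In the chart the values of the characters are those of the smooth function `bodyFun`, whichever
family `φ` is chosen. The values of `g` away from the image of `U` play no role. -/
theorem contDiffAt_of_eq_hom {x : X.carrier} (hx : x ∈ c.chart.source)
    (φ : ∀ y, PointCharacter X y) {U : Opens X.carrier} (hU : x ∈ U)
    (a : X.presheaf.obj (op U)) {g : EuclideanSpace ℝ (Fin n) → ℝ}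
    (hg : ∀ y (hy : y ∈ U), y ∈ c.chart.source → g (c.chart y) = (φ y).hom U hy a) :
    ContDiffAt ℝ ∞ g (c.chart x) := by
  have hw := c.mem_imageOpens hx hU
  rw [← contMDiffAt_iff_contDiffAt]
  refine (contMDiffAt_subtype_iff (U := c.imageOpens U) (x := ⟨c.chart x, hw⟩)).mp ?_
  have : (fun w : c.imageOpens U => g w) = c.bodyFun U a := by
    funext ⟨w, hw⟩
    have h1 := c.chart.right_inv hw.1
    have h2 := c.chart.map_target hw.1
    have h3 := hg _ hw.2 h2
    rw [c.hom_eq_bodyFun h2] at h3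
    simpa only [h1] using h3
  rw [this]
  exact (c.bodyFun U a).contMDiff _

end SuperChart

namespace Supermanifold

variable (M : Supermanifold)

/-- Evaluation of sections at a point of a supermanifold. -/
noncomputable def pointCharacter (x : M.carrier) : PointCharacter M.toSuperringedSpace x :=
  (M.exists_chart x).choose.character (M.exists_chart x).choose_spec

/-- Both characters are evaluation of the underlying function in one and the same chart. -/
theorem pointCharacter_unique {x : M.carrier} (φ ψ : PointCharacter M.toSuperringedSpace x) :
    φ = ψ := by
  ext U hU a
  rw [(M.exists_chart x).choose.hom_eq_bodyFun (M.exists_chart x).choose_spec,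
    (M.exists_chart x).choose.hom_eq_bodyFun (M.exists_chart x).choose_spec]

end Supermanifold

/-! ## Smoothness of reduced maps -/

namespace Supermanifold

variable {M N : Supermanifold}

/-- Each coordinate of the reduced map underlies a section of `M`: the pullback of a coordinate
function of `d`. The charts are arbitrary, so that `φ = 𝟙 M` also covers transition maps. -/
theorem contDiffAt_reducedMap (φ : M ⟶ N) {m n p q : ℕ}
    (c : SuperChart M.toSuperringedSpace m p) (d : SuperChart N.toSuperringedSpace n q)
    {x : M.Reduced} (hx : x ∈ c.chart.source) (hφx : reducedMap φ x ∈ d.chart.source) :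
    ContDiffAt ℝ ∞ (fun w => d.chart (reducedMap φ (c.chart.symm w))) (c.chart x) := by
  rw [contDiffAt_euclidean]
  intro i
  let W : Opens (EuclideanSpace ℝ (Fin n)) := ⟨d.chart.target, d.chart.open_target⟩
  let f : C^∞⟮𝓡 n, W; 𝓘(ℝ, ℝ), ℝ⟯ := ⟨fun w => (w : EuclideanSpace ℝ (Fin n)) i,
    (EuclideanSpace.proj i : EuclideanSpace ℝ (Fin n) →L[ℝ] ℝ).contMDiff.comp
      contMDiff_subtype_val⟩
  let s : SuperDomain.Sections n q W := f ⊗ₜ 1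
  let b := (d.iso W subset_rfl).symm s
  refine c.contDiffAt_of_eq_hom hx M.pointCharacter
    (U := (Opens.map (SuperringedSpace.Hom.toHom φ).base).obj (d.chart.preimageOpens W))
    ⟨hφx, d.chart.map_source hφx⟩ (((SuperringedSpace.Hom.toHom φ).c.app _).hom b) ?_
  intro y hy hyc
  rw [c.chart.left_inv hyc]
  -- The image under `φ` of the character at `y` is a character at the image point, hence evaluation
  -- there.
  have h := d.hom_iso_symm hy.1 (PointCharacter.map φ (M.pointCharacter y)) (W := W)
    subset_rfl hy.2 s
  refine Eq.trans ?_ h.symm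
  rw [SuperDomain.body_tmul, map_one, map_one, mul_one]
  rfl

theorem continuous_reducedMap (φ : M ⟶ N) : Continuous (reducedMap φ) :=
  (SuperringedSpace.Hom.toHom φ).base.hom.continuous

theorem contMDiff_reducedMap (φ : M ⟶ N) :
    ContMDiff (𝓡 M.evenDim) (𝓡 N.evenDim) ∞ (reducedMap φ) := by
  intro x
  rw [contMDiffAt_iff]
  refine ⟨(continuous_reducedMap φ).continuousAt, ?_⟩
  have := contDiffAt_reducedMap φ (M.exists_chart x).choose (N.exists_chart (reducedMap φ x)).choose
    (M.exists_chart x).choose_spec (N.exists_chart (reducedMap φ x)).choose_spec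
  simp only [mfld_simps, contDiffWithinAt_univ]
  exact this

/-- A transition map is the reduced identity morphism read in two charts. -/
instance (M : Supermanifold) : IsManifold (𝓡 M.evenDim) ∞ M.Reduced := by
  apply isManifold_of_contDiffOn
  rintro _ _ ⟨c, rfl⟩ ⟨d, rfl⟩ w hw
  simp only [mfld_simps] at hw
  have := contDiffAt_reducedMap (𝟙 M) c d (x := c.chart.symm w) (c.chart.map_target hw.1) hw.2
  rw [c.chart.right_inv hw.1] at this
  exact this.contDiffWithinAt

/-- The function underlying a section is smooth. -/
theorem contMDiffAt_of_eq_hom {U : Opens M.carrier} (a : M.presheaf.obj (op U))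
    {g : M.Reduced → ℝ}
    (hg : ∀ y (hy : y ∈ U), g y = (M.pointCharacter y).hom U hy a)
    {x : M.Reduced} (hx : x ∈ U) : ContMDiffAt (𝓡 M.evenDim) 𝓘(ℝ, ℝ) ∞ g x := by
  obtain ⟨c, hc⟩ := M.exists_chart x
  have hcm : c.chart ∈ IsManifold.maximalAtlas (𝓡 M.evenDim) ∞ M.Reduced :=
    IsManifold.subset_maximalAtlas ⟨c, rfl⟩
  have hopen : c.chart.source ∩ U ∈ nhds x := (c.chart.open_source.inter U.2).mem_nhds ⟨hc, hx⟩
  have h := c.contDiffAt_of_eq_hom hc M.pointCharacter hx a (g := fun w => g (c.chart.symm w))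
    (fun y hy hyc => by rw [c.chart.left_inv hyc, hg y hy])
  have h2 : ContMDiffAt (𝓡 M.evenDim) 𝓘(ℝ, ℝ) ∞
      (fun y : M.Reduced => g (c.chart.symm (c.chart y))) x :=
    h.contMDiffAt.comp x (contMDiffAt_of_mem_maximalAtlas hcm hc)
  refine h2.congr_of_eventuallyEq ?_
  filter_upwards [hopen] with y hy
  rw [c.chart.left_inv hy.1]

end Supermanifold

/-! ## The supermanifold `ℝ^{k|0}` -/

/-- The grading of an algebra in which everything is even. -/
def evenGrading (A : Type*) [Ring A] [Algebra ℝ A] (i : ZMod 2) : Submodule ℝ A :=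
  if i = 0 then ⊤ else ⊥

theorem mem_evenGrading_zero {A : Type*} [Ring A] [Algebra ℝ A] (a : A) :
    a ∈ evenGrading A 0 :=
  Submodule.mem_top

theorem mem_evenGrading_iff {A : Type*} [Ring A] [Algebra ℝ A] {a : A} {i : ZMod 2} :
    a ∈ evenGrading A i ↔ (i = 0 ∨ a = 0) := by
  by_cases hi : i = 0 <;> simp [evenGrading, hi]

/-- The graded algebra structure of an algebra in which everything is even. -/
@[reducible]
noncomputable def evenGradedAlgebra (A : Type*) [Ring A] [Algebra ℝ A] :
    GradedAlgebra (evenGrading A) :=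
  haveI : SetLike.GradedMonoid (evenGrading A) :=
    { one_mem := mem_evenGrading_zero 1
      mul_mem := by
        intro i j a b ha hb
        rw [mem_evenGrading_iff] at *
        rcases ha with rfl | rfl
        · rcases hb with rfl | rfl <;> simp
        · simp }
  { toDecomposition := DirectSum.Decomposition.ofLinearMap _
      ((DirectSum.lof ℝ (ZMod 2) (fun i => evenGrading A i) 0).comp
        (LinearMap.codRestrict (evenGrading A 0) LinearMap.id mem_evenGrading_zero))
      (by ext a; simp)
      (by
        ext i ⟨a, ha⟩ : 2
        rcases mem_evenGrading_iff.mp ha with rfl | rfl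
        · simp; rfl
        · have : (⟨0, ha⟩ : evenGrading A i) = 0 := rfl
          rw [this, map_zero, map_zero]) }

open SuperDomain in
/-- The presheaf of algebras of smooth functions on `ℝᵏ`. -/
noncomputable def smoothPresheaf (k : ℕ) :
    TopCat.Presheaf (AlgCat.{0} ℝ) (TopCat.of (EuclideanSpace ℝ (Fin k))) where
  obj U := AlgCat.of ℝ C^∞⟮𝓡 k, (unop U : Opens (EuclideanSpace ℝ (Fin k))); 𝓘(ℝ, ℝ), ℝ⟯
  map r := AlgCat.ofHom (restrictFun (leOfHom r.unop))
  map_id _ := rfl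
  map_comp _ _ := rfl

/-- The sheaf condition can be checked on underlying sets, where it is gluing of smooth functions.
-/
theorem smoothPresheaf_isSheaf (k : ℕ) : (smoothPresheaf k).IsSheaf := by
  rw [TopCat.Presheaf.isSheaf_iff_isSheaf_comp (forget (AlgCat.{0} ℝ))]
  exact (smoothSheaf (𝓡 k) 𝓘(ℝ, ℝ) (EuclideanSpace ℝ (Fin k)) ℝ).property

/-- `ℝ^{k|0}` as a superringed space. -/
noncomputable def superEuclideanSpace (k : ℕ) : SuperringedSpace where
  carrier := TopCat.of (EuclideanSpace ℝ (Fin k))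
  presheaf := smoothPresheaf k
  IsSheaf := smoothPresheaf_isSheaf k
  grading U := evenGrading ((smoothPresheaf k).obj U)
  gradedAlgebra U := evenGradedAlgebra _
  map_mem r i a ha := by
    rw [mem_evenGrading_iff] at *
    exact ha.imp_right fun h => by rw [h, map_zero]
  supercomm U i j a b ha hb := by
    rw [mem_evenGrading_iff] at *
    have hab : a * b = b * a :=
      mul_comm (show C^∞⟮𝓡 k, (unop U : Opens (EuclideanSpace ℝ (Fin k))); 𝓘(ℝ, ℝ), ℝ⟯ from a) b
    rcases ha with rfl | rfl
    · simpa using hab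
    · simp

namespace SuperDomain

theorem algebraMap_algebraMapInv_fin_zero (η : ExteriorAlgebra ℝ (Fin 0 → ℝ)) :
    algebraMap ℝ _ (ExteriorAlgebra.algebraMapInv η) = η := by
  have : (Algebra.ofId ℝ _).comp ExteriorAlgebra.algebraMapInv =
      AlgHom.id ℝ (ExteriorAlgebra ℝ (Fin 0 → ℝ)) := by
    apply ExteriorAlgebra.hom_ext
    ext i
    exact i.elim0
  exact DFunLike.congr_fun this η

/-- Without odd generators, sections are smooth functions. -/
noncomputable def bodyEquiv (k : ℕ) (W : Opens (EuclideanSpace ℝ (Fin k))) :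
    C^∞⟮𝓡 k, W; 𝓘(ℝ, ℝ), ℝ⟯ ≃ₐ[ℝ] Sections k 0 W :=
  AlgEquiv.ofAlgHom Algebra.TensorProduct.includeLeft (body W)
    (by
      apply Algebra.TensorProduct.ext'
      intro f η
      rw [AlgHom.comp_apply, body_tmul, AlgHom.id_apply, mul_comm, ← Algebra.smul_def,
        Algebra.TensorProduct.includeLeft_apply, TensorProduct.smul_tmul,
        ← Algebra.algebraMap_eq_smul_one, algebraMap_algebraMapInv_fin_zero])
    (by
      ext f w
      simp [body_tmul])

theorem bodyEquiv_restrictFun {k : ℕ} {W W' : Opens (EuclideanSpace ℝ (Fin k))} (h : W' ≤ W)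
    (f : C^∞⟮𝓡 k, W; 𝓘(ℝ, ℝ), ℝ⟯) :
    bodyEquiv k W' (restrictFun h f) = restrict 0 h (bodyEquiv k W f) :=
  (Algebra.TensorProduct.map_tmul (restrictFun h) (AlgHom.id ℝ _) f 1).symm

/-- Without generators every element is a scalar, hence even, and the even and odd parts intersect
trivially. -/
theorem eq_zero_of_mem_evenOdd_one {η : ExteriorAlgebra ℝ (Fin 0 → ℝ)}
    (hη : η ∈ CliffordAlgebra.evenOdd (0 : QuadraticForm ℝ (Fin 0 → ℝ)) 1) : η = 0 := by
  refine Submodule.disjoint_def.mp (CliffordAlgebra.evenOdd_isCompl _).disjoint η ?_ hη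
  rw [← algebraMap_algebraMapInv_fin_zero η]
  exact SetLike.algebraMap_mem_graded (CliffordAlgebra.evenOdd 0) _

theorem bodyEquiv_mem_grading {k : ℕ} {W : Opens (EuclideanSpace ℝ (Fin k))} {i : ZMod 2}
    {f : C^∞⟮𝓡 k, W; 𝓘(ℝ, ℝ), ℝ⟯} :
    bodyEquiv k W f ∈ grading k 0 W i ↔ f ∈ evenGrading _ i := by
  rw [mem_evenGrading_iff]
  constructor
  · rintro ⟨t, ht⟩
    by_cases hi : i = 0
    · exact Or.inl hi
    right
    obtain rfl : i = 1 := (by decide : ∀ j : ZMod 2, j ≠ 0 → j = 1) i hi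
    have h0 : ∀ t : C^∞⟮𝓡 k, W; 𝓘(ℝ, ℝ), ℝ⟯ ⊗[ℝ]
        CliffordAlgebra.evenOdd (0 : QuadraticForm ℝ (Fin 0 → ℝ)) 1, t = 0 := by
      intro t
      induction t with
      | zero => rfl
      | tmul g η =>
        rw [show η = 0 from Subtype.ext (eq_zero_of_mem_evenOdd_one η.2), TensorProduct.tmul_zero]
      | add s t hs ht => rw [hs, ht, add_zero]
    rw [h0 t, map_zero] at ht
    exact (map_eq_zero_iff _ (bodyEquiv k W).injective).mp ht.symm
  · rintro (rfl | rfl)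
    · exact ⟨f ⊗ₜ ⟨1, Submodule.one_le.mp (CliffordAlgebra.one_le_evenOdd_zero _)⟩, rfl⟩
    · rw [map_zero]
      exact Submodule.zero_mem _

end SuperDomain

theorem preimageOpens_refl {k : ℕ} (W : Opens (EuclideanSpace ℝ (Fin k))) :
    (OpenPartialHomeomorph.refl (EuclideanSpace ℝ (Fin k))).preimageOpens W = W := by
  ext
  simp [OpenPartialHomeomorph.preimageOpens]

open SuperDomain in
/-- The identity chart of `ℝ^{k|0}`. -/
noncomputable def superEuclideanChart (k : ℕ) : SuperChart (superEuclideanSpace k) k 0 where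
  chart := OpenPartialHomeomorph.refl _
  -- The preimage of `W` under the identity chart equals `W` only propositionally, so sections are
  -- moved across by restriction in both directions.
  iso W _ := (AlgEquiv.ofAlgHom (restrictFun (preimageOpens_refl W).ge)
    (restrictFun (preimageOpens_refl W).le) rfl rfl).trans (bodyEquiv k W)
  iso_mem W _ i a := by
    refine bodyEquiv_mem_grading.trans ?_
    rw [mem_evenGrading_iff]
    refine Iff.trans ?_ (mem_evenGrading_iff (A := (smoothPresheaf k).obj _)).symm
    exact or_congr_right (map_eq_zero_iff _ (AlgEquiv.injective _))
  iso_restrict W W' h _ _ a := bodyEquiv_restrictFun h (restrictFun (preimageOpens_refl W).ge a)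

/-- `ℝ^{k|0}` as a supermanifold. -/
noncomputable def superEuclidean (k : ℕ) : Supermanifold where
  toSuperringedSpace := superEuclideanSpace k
  evenDim := k
  oddDim := 0
  t2 := inferInstanceAs (T2Space (EuclideanSpace ℝ (Fin k)))
  secondCountable := inferInstanceAs (SecondCountableTopology (EuclideanSpace ℝ (Fin k)))
  exists_chart _ := ⟨superEuclideanChart k, Set.mem_univ _⟩

/-! ### Morphisms out of `ℝ^{k|0}` and smooth families -/

namespace Supermanifold

variable {N : Supermanifold} {k : ℕ}

/-- The reduced map of a morphism from `ℝ^{k|0}`, on the standard manifold `ℝᵏ`. -/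
noncomputable def toFun (φ : superEuclidean k ⟶ N) : EuclideanSpace ℝ (Fin k) → N.Reduced :=
  reducedMap φ

theorem contMDiff_toFun (φ : superEuclidean k ⟶ N) :
    ContMDiff (𝓡 k) (𝓡 N.evenDim) ∞ (toFun φ) := by
  intro w
  rw [contMDiffAt_iff]
  refine ⟨(continuous_reducedMap φ).continuousAt, ?_⟩
  have := contDiffAt_reducedMap φ (superEuclideanChart k) (N.exists_chart (toFun φ w)).choose
    (x := w) (Set.mem_univ _) (N.exists_chart (toFun φ w)).choose_spec
  simp only [mfld_simps, contDiffWithinAt_univ]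
  exact this

/-- The character of `ℝ^{k|0}` given by evaluation of functions. -/
noncomputable def evalCharacter (w : EuclideanSpace ℝ (Fin k)) :
    PointCharacter (superEuclideanSpace k) w where
  hom _ hU := SuperDomain.evalFun ⟨w, hU⟩
  hom_map _ _ _ _ _ _ := rfl

/-- A morphism from `ℝ^{k|0}` is determined by its reduced map. -/
theorem hom_ext_of_toFun_eq {φ ψ : superEuclidean k ⟶ N} (h : toFun φ = toFun ψ) : φ = ψ := by
  obtain ⟨⟨b, c⟩, hφ⟩ := φ
  obtain ⟨⟨b', c'⟩, hψ⟩ := ψ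
  obtain rfl : b = b' := by
    ext w
    exact congrFun h w
  -- Sections of `ℝ^{k|0}` are determined by their values. Both values at `w` come from characters
  -- of `N` at the same point, which coincide.
  obtain rfl : c = c' := by
    ext U a
    refine ContMDiffMap.ext fun w => ?_
    exact congrArg (fun χ : PointCharacter N.toSuperringedSpace _ => χ.hom U w.2 a)
      (N.pointCharacter_unique
        (PointCharacter.map (X := superEuclideanSpace k) ⟨⟨b, c⟩, hφ⟩ (evalCharacter w.1))
        (PointCharacter.map (X := superEuclideanSpace k) ⟨⟨b, c'⟩, hψ⟩ (evalCharacter w.1)))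
  rfl

/-- The pullback along a smooth map `ℝᵏ → |N|` of the function underlying a section. -/
noncomputable def pullback {f : EuclideanSpace ℝ (Fin k) → N.Reduced}
    (hf : ContMDiff (𝓡 k) (𝓡 N.evenDim) ∞ f) (U : Opens N.carrier)
    (V : Opens (EuclideanSpace ℝ (Fin k))) (hV : ∀ w ∈ V, f w ∈ U) :
    N.presheaf.obj (op U) →ₐ[ℝ] C^∞⟮𝓡 k, V; 𝓘(ℝ, ℝ), ℝ⟯ where
  toFun a := ⟨fun w => (N.pointCharacter (f w)).hom U (hV w w.2) a, by
    classical
    intro w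
    -- Extension by zero only serves to have a function on all of `|N|`; smoothness is used at
    -- points of `U`.
    have h := contMDiffAt_of_eq_hom a (g := fun y => if hy : y ∈ U then
      (N.pointCharacter y).hom U hy a else 0)
      (fun y hy => dif_pos hy) (hV w w.2)
    have h' := (h.comp w.1 hf.contMDiffAt).comp w contMDiff_subtype_val.contMDiffAt
    refine h'.congr_of_eventuallyEq (Filter.Eventually.of_forall fun v => ?_)
    exact (dif_pos (hV v v.2) : (if hy : f v ∈ U then
      (N.pointCharacter (f v)).hom U hy a else 0) = _).symm⟩
  map_one' := by ext w; exact map_one ((N.pointCharacter (f w)).hom U (hV w w.2))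
  map_mul' a b := by ext w; exact map_mul ((N.pointCharacter (f w)).hom U (hV w w.2)) a b
  map_zero' := by ext w; exact map_zero ((N.pointCharacter (f w)).hom U (hV w w.2))
  map_add' a b := by ext w; exact map_add ((N.pointCharacter (f w)).hom U (hV w w.2)) a b
  commutes' r := by ext w; exact AlgHom.commutes ((N.pointCharacter (f w)).hom U (hV w w.2)) r

/-- Odd sections vanish at every point, so they pull back to zero, the only odd section of
`ℝ^{k|0}`. -/
theorem pullback_mem {f : EuclideanSpace ℝ (Fin k) → N.Reduced}
    (hf : ContMDiff (𝓡 k) (𝓡 N.evenDim) ∞ f) (U : Opens N.carrier)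
    (V : Opens (EuclideanSpace ℝ (Fin k))) (hV : ∀ w ∈ V, f w ∈ U) (i : ZMod 2)
    (a : N.presheaf.obj (op U)) (ha : a ∈ N.grading (op U) i) :
    pullback hf U V hV a ∈ evenGrading _ i := by
  refine mem_evenGrading_iff.mpr ?_
  by_cases hi : i = 0
  · exact Or.inl hi
  obtain rfl : i = 1 := (by decide : ∀ j : ZMod 2, j ≠ 0 → j = 1) i hi
  exact Or.inr (ContMDiffMap.ext fun w =>
    (N.pointCharacter (f w)).hom_eq_zero_of_mem_grading_one (hV w w.2) ha)

theorem pullback_map {f : EuclideanSpace ℝ (Fin k) → N.Reduced}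
    (hf : ContMDiff (𝓡 k) (𝓡 N.evenDim) ∞ f) {U U' : Opens N.carrier} (r : op U ⟶ op U')
    {V V' : Opens (EuclideanSpace ℝ (Fin k))} (hV : ∀ w ∈ V, f w ∈ U) (hV' : ∀ w ∈ V', f w ∈ U')
    (h : V' ≤ V) (a : N.presheaf.obj (op U)) :
    pullback hf U' V' hV' ((N.presheaf.map r).hom a) =
      SuperDomain.restrictFun h (pullback hf U V hV a) :=
  ContMDiffMap.ext fun w =>
    (N.pointCharacter (f w)).hom_map U U' r (hV' w w.2) (hV w (h w.2)) a

/-- The morphism of presheafed spaces given by a smooth map `ℝᵏ → |N|`. -/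
noncomputable def ofContMDiffAux (f : EuclideanSpace ℝ (Fin k) → N.Reduced)
    (hf : ContMDiff (𝓡 k) (𝓡 N.evenDim) ∞ f) :
    (superEuclideanSpace k).toPresheafedSpace ⟶ N.toPresheafedSpace where
  base := TopCat.ofHom ⟨f, hf.continuous⟩
  c :=
    { app := fun U => AlgCat.ofHom (pullback hf U.unop
        ((Opens.map (TopCat.ofHom ⟨f, hf.continuous⟩)).obj U.unop) fun _ hw => hw)
      naturality := fun U U' r => by
        apply AlgCat.hom_ext
        refine AlgHom.ext fun a => ?_
        exact pullback_map hf (U := U.unop) (U' := U'.unop) r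
          (V := (Opens.map (TopCat.ofHom ⟨f, hf.continuous⟩)).obj U.unop)
          (V' := (Opens.map (TopCat.ofHom ⟨f, hf.continuous⟩)).obj U'.unop)
          (fun _ hw => hw) (fun _ hw => hw) (fun _ hw => leOfHom r.unop hw) a }

/-- The morphism `ℝ^{k|0} ⟶ N` with a given smooth reduced map. -/
noncomputable def ofContMDiff (f : EuclideanSpace ℝ (Fin k) → N.Reduced)
    (hf : ContMDiff (𝓡 k) (𝓡 N.evenDim) ∞ f) : superEuclidean k ⟶ N :=
  SuperringedSpace.Hom.mk (X := superEuclideanSpace k) (Y := N.toSuperringedSpace)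
    (ofContMDiffAux f hf)
    (fun U i a ha => pullback_mem hf U.unop
      ((Opens.map (TopCat.ofHom ⟨f, hf.continuous⟩)).obj U.unop) (fun _ hw => hw) i a ha)

theorem toFun_ofContMDiff (f : EuclideanSpace ℝ (Fin k) → N.Reduced)
    (hf : ContMDiff (𝓡 k) (𝓡 N.evenDim) ∞ f) : toFun (ofContMDiff f hf) = f :=
  rfl

theorem toFun_comp {M : Supermanifold} (φ : superEuclidean k ⟶ M) (ψ : M ⟶ N)
    (w : EuclideanSpace ℝ (Fin k)) : toFun (φ ≫ ψ) w = reducedMap ψ (toFun φ w) :=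
  rfl

/-- The morphism `ℝ^{k|0} ⟶ N` that is constant with value `x`. -/
noncomputable def const (k : ℕ) (x : N.Reduced) : superEuclidean k ⟶ N :=
  ofContMDiff (fun _ => x) contMDiff_const

theorem toFun_const (x : N.Reduced) (w : EuclideanSpace ℝ (Fin k)) : toFun (const k x) w = x := by
  rw [const, toFun_ofContMDiff]

theorem const_comp {M : Supermanifold} (x : M.Reduced) (ψ : M ⟶ N) :
    const k x ≫ ψ = const k (reducedMap ψ x) :=
  hom_ext_of_toFun_eq (funext fun w => by rw [toFun_comp, toFun_const, toFun_const])

/-- A neighbourhood of every point of the reduced manifold is parametrized by all of `ℝⁿ`. -/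
theorem exists_parametrization (M : Supermanifold) (x : M.Reduced) :
    ∃ (j : EuclideanSpace ℝ (Fin M.evenDim) → M.Reduced)
      (i : M.Reduced → EuclideanSpace ℝ (Fin M.evenDim)),
      ContMDiff (𝓡 M.evenDim) (𝓡 M.evenDim) ∞ j ∧ ContMDiffAt (𝓡 M.evenDim) (𝓡 M.evenDim) ∞ i x ∧
      ∀ᶠ y in nhds x, j (i y) = y := by
  set e := chartAt (EuclideanSpace ℝ (Fin M.evenDim)) x
  have hx : x ∈ e.source := mem_chart_source _ x
  obtain ⟨r, hr, hball⟩ := Metric.isOpen_iff.mp e.open_target (e x) (e.map_source hx)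
  -- Test families are defined on all of `ℝᵏ`, so the whole space is squeezed diffeomorphically onto
  -- a ball inside the chart target.
  set u := OpenPartialHomeomorph.univBall (e x) r
  have hut : u.target = Metric.ball (e x) r := OpenPartialHomeomorph.univBall_target _ hr
  have hus : u.source = Set.univ := OpenPartialHomeomorph.univBall_source _ r
  have he : ContMDiffAt (𝓡 M.evenDim) (𝓡 M.evenDim) ∞ e x :=
    contMDiffOn_chart.contMDiffAt (e.open_source.mem_nhds hx)
  refine ⟨e.symm ∘ u, u.symm ∘ e, ?_, ?_, ?_⟩
  · refine contMDiffOn_chart_symm.comp_contMDiff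
      OpenPartialHomeomorph.contDiff_univBall.contMDiff fun w => hball ?_
    rw [← hut]
    exact u.map_source (hus ▸ Set.mem_univ w)
  · refine ContMDiffAt.comp x ?_ he
    exact (OpenPartialHomeomorph.contDiffOn_univBall_symm.contDiffAt
      (Metric.ball_mem_nhds _ hr)).contMDiffAt
  · filter_upwards [e.open_source.mem_nhds hx,
      he.continuousAt.preimage_mem_nhds (Metric.ball_mem_nhds (e x) hr)] with y hy hyb
    simp only [Function.comp_apply]
    rw [u.right_inv (hut ▸ hyb), e.left_inv hy]

/-- A map on `|M| × |M| × |M|` is smooth if it is smooth along all smooth families parametrized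
by `ℝᵏ`. -/
theorem contMDiff_of_families {M N : Supermanifold}
    (h : M.Reduced × M.Reduced × M.Reduced → N.Reduced)
    (H : ∀ (k : ℕ) (f₁ f₂ f₃ : EuclideanSpace ℝ (Fin k) → M.Reduced),
      ContMDiff (𝓡 k) (𝓡 M.evenDim) ∞ f₁ → ContMDiff (𝓡 k) (𝓡 M.evenDim) ∞ f₂ →
      ContMDiff (𝓡 k) (𝓡 M.evenDim) ∞ f₃ →
      ContMDiff (𝓡 k) (𝓡 N.evenDim) ∞ fun w => h (f₁ w, f₂ w, f₃ w)) :
    ContMDiff ((𝓡 M.evenDim).prod ((𝓡 M.evenDim).prod (𝓡 M.evenDim))) (𝓡 N.evenDim) ∞ h := by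
  rintro ⟨x, y, z⟩
  obtain ⟨j₁, i₁, hj₁, hi₁, h₁⟩ := M.exists_parametrization x
  obtain ⟨j₂, i₂, hj₂, hi₂, h₂⟩ := M.exists_parametrization y
  obtain ⟨j₃, i₃, hj₃, hi₃, h₃⟩ := M.exists_parametrization z
  let E := EuclideanSpace ℝ (Fin M.evenDim)
  -- The three parametrizations form one family over `E × E × E`, identified linearly with some
  -- `ℝᵏ`. Near the given point, `h` is this family composed with the smooth local inverses.
  let L : (E × E × E) ≃L[ℝ] EuclideanSpace ℝ (Fin (Module.finrank ℝ (E × E × E))) := toEuclidean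
  have hF := H _ (fun w => j₁ (L.symm w).1) (fun w => j₂ (L.symm w).2.1)
    (fun w => j₃ (L.symm w).2.2)
    (hj₁.comp (contDiff_fst.comp L.symm.contDiff).contMDiff)
    (hj₂.comp (contDiff_fst.comp (contDiff_snd.comp L.symm.contDiff)).contMDiff)
    (hj₃.comp (contDiff_snd.comp (contDiff_snd.comp L.symm.contDiff)).contMDiff)
  have hG : ContMDiffAt ((𝓡 M.evenDim).prod ((𝓡 M.evenDim).prod (𝓡 M.evenDim)))
      𝓘(ℝ, E × E × E) ∞ (fun p : M.Reduced × M.Reduced × M.Reduced =>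
        (i₁ p.1, i₂ p.2.1, i₃ p.2.2)) (x, y, z) :=
    (hi₁.comp (x, y, z) contMDiffAt_fst).prodMk_space
      ((hi₂.comp (x, y, z) (contMDiff_fst.comp contMDiff_snd).contMDiffAt).prodMk_space
        (hi₃.comp (x, y, z) (contMDiff_snd.comp contMDiff_snd).contMDiffAt))
  have hLG := L.contDiff.contMDiff.contMDiffAt.comp (x, y, z) hG
  refine (hF.contMDiffAt.comp (x, y, z) hLG).congr_of_eventuallyEq ?_
  filter_upwards [h₁.prod_nhds (h₂.prod_nhds h₃)] with p hp
  simp [hp.1, hp.2.1, hp.2.2]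

end Supermanifold

/-! ### The reduced ternary product and products of supermanifolds -/

namespace LieSupersemiheap

open Supermanifold

variable {S : Supermanifold} (A : LieSupersemiheap S)

theorem comp_op {T T' : Supermanifold} (ψ : T' ⟶ T) (f g h : T ⟶ S) :
    ψ ≫ (A.points T).op f g h = (A.points T').op (ψ ≫ f) (ψ ≫ g) (ψ ≫ h) :=
  A.isHom ψ f g h

/-- The ternary product of the points of the reduced manifold. -/
noncomputable def reducedOp (x y z : S.Reduced) : S.Reduced :=
  toFun ((A.points (superEuclidean 0)).op (const 0 x) (const 0 y) (const 0 z)) 0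

/-- Naturality of `μ` along the morphism `ℝ^{0|0} ⟶ T` that picks out `t`. -/
theorem isReducedMap_reducedOp : A.IsReducedMap A.reducedOp := by
  intro T f g h t
  rw [reducedOp, ← const_comp t f, ← const_comp t g, ← const_comp t h, ← A.comp_op, toFun_comp,
    toFun_const]

variable {A}

theorem IsReducedMap.apply_eq {ρ : S.Reduced → S.Reduced → S.Reduced → S.Reduced}
    (hρ : A.IsReducedMap ρ) {k : ℕ} (f g h : superEuclidean k ⟶ S)
    (w : EuclideanSpace ℝ (Fin k)) :
    toFun ((A.points (superEuclidean k)).op f g h) w = ρ (toFun f w) (toFun g w) (toFun h w) :=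
  hρ _ f g h w

/-- Every triple of points underlies a triple of `ℝ^{0|0}`-points, so the defining property fixes
all values. -/
theorem IsReducedMap.eq {ρ ρ' : S.Reduced → S.Reduced → S.Reduced → S.Reduced}
    (hρ : A.IsReducedMap ρ) (hρ' : A.IsReducedMap ρ') : ρ = ρ' := by
  funext x y z
  have h := hρ.apply_eq (const 0 x) (const 0 y) (const 0 z) 0
  rw [hρ'.apply_eq] at h
  simpa only [toFun_const] using h.symm

variable (A)

theorem reducedOp_toFun {k : ℕ} (f g h : superEuclidean k ⟶ S) (w : EuclideanSpace ℝ (Fin k)) :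
    A.reducedOp (toFun f w) (toFun g w) (toFun h w) =
      toFun ((A.points (superEuclidean k)).op f g h) w :=
  (A.isReducedMap_reducedOp.apply_eq f g h w).symm

/-- The semiheap structure on the reduced manifold. -/
noncomputable def reducedSemiheap : Semiheap S.Reduced where
  op := A.reducedOp
  para_assoc_left x₁ x₂ x₃ x₄ x₅ := by
    have h := congrArg (fun φ => toFun φ 0) ((A.points (superEuclidean 0)).para_assoc_left
      (const 0 x₁) (const 0 x₂) (const 0 x₃) (const 0 x₄) (const 0 x₅))
    simpa only [← reducedOp_toFun, toFun_const] using h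
  para_assoc_right x₁ x₂ x₃ x₄ x₅ := by
    have h := congrArg (fun φ => toFun φ 0) ((A.points (superEuclidean 0)).para_assoc_right
      (const 0 x₁) (const 0 x₂) (const 0 x₃) (const 0 x₄) (const 0 x₅))
    simpa only [← reducedOp_toFun, toFun_const] using h

theorem isHeap_reducedSemiheap (hA : A.IsSuperheap) : A.reducedSemiheap.IsHeap := by
  intro x y
  have h := hA (superEuclidean 0) (const 0 x) (const 0 y)
  have h₁ := congrArg (fun φ => toFun φ 0) h.1
  have h₂ := congrArg (fun φ => toFun φ 0) h.2
  simp only [← reducedOp_toFun, toFun_const] at h₁ h₂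
  exact ⟨h₁, h₂⟩

theorem isLieSemiheap_reducedSemiheap : IsLieSemiheap S.evenDim A.reducedSemiheap where
  t2 := S.t2
  secondCountable := S.secondCountable
  isManifold := inferInstance
  smooth := by
    apply contMDiff_of_families
    intro k f₁ f₂ f₃ h₁ h₂ h₃
    -- The three families lift to `ℝ^{k|0}`-points; the reduced map of their product is the map in
    -- question.
    refine (contMDiff_toFun ((A.points (superEuclidean k)).op (ofContMDiff f₁ h₁)
      (ofContMDiff f₂ h₂) (ofContMDiff f₃ h₃))).congr fun w => ?_
    rw [← reducedOp_toFun, toFun_ofContMDiff, toFun_ofContMDiff, toFun_ofContMDiff]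
    rfl

/-! ### Products -/

variable {c : Limits.Fan fun _ : Fin 3 => S}

theorem exists_lift (hc : Limits.IsLimit c) {T : Supermanifold} (f₁ f₂ f₃ : T ⟶ S) :
    ∃ u : T ⟶ c.pt, u ≫ c.proj 0 = f₁ ∧ u ≫ c.proj 1 = f₂ ∧ u ≫ c.proj 2 = f₃ := by
  let f : ∀ i : Fin 3, T ⟶ S := ![f₁, f₂, f₃]
  exact ⟨Limits.Fan.IsLimit.lift hc f, Limits.Fan.IsLimit.fac hc f 0,
    Limits.Fan.IsLimit.fac hc f 1, Limits.Fan.IsLimit.fac hc f 2⟩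

theorem reducedProj_toFun {k : ℕ} (u : superEuclidean k ⟶ c.pt) (w : EuclideanSpace ℝ (Fin k)) :
    reducedProj c (toFun u w) =
      (toFun (u ≫ c.proj 0) w, toFun (u ≫ c.proj 1) w, toFun (u ≫ c.proj 2) w) :=
  rfl

/-- Points of a reduced manifold are `ℝ^{0|0}`-points, so this is the universal property of the
product tested on `ℝ^{0|0}`. -/
theorem bijective_reducedProj (hc : Limits.IsLimit c) : Function.Bijective (reducedProj c) := by
  constructor
  · intro p q hpq
    have h : const 0 p = const 0 q := by
      refine Limits.Fan.IsLimit.hom_ext hc _ _ fun i => ?_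
      rw [const_comp, const_comp]
      congr 1
      fin_cases i
      · exact congrArg (fun t => t.1) hpq
      · exact congrArg (fun t => t.2.1) hpq
      · exact congrArg (fun t => t.2.2) hpq
    have h' := congrArg (fun φ => toFun φ 0) h
    simpa only [toFun_const] using h'
  · rintro ⟨x, y, z⟩
    obtain ⟨u, h₁, h₂, h₃⟩ := exists_lift hc (const 0 x) (const 0 y) (const 0 z)
    exact ⟨toFun u 0, by rw [reducedProj_toFun, h₁, h₂, h₃, toFun_const, toFun_const, toFun_const]⟩

/-- The reduced manifold of a product is the product of the reduced manifolds. -/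
noncomputable def reducedProdDiffeomorph (hc : Limits.IsLimit c) :
    Diffeomorph (𝓡 c.pt.evenDim) ((𝓡 S.evenDim).prod ((𝓡 S.evenDim).prod (𝓡 S.evenDim)))
      c.pt.Reduced (S.Reduced × S.Reduced × S.Reduced) ∞ where
  toEquiv := Equiv.ofBijective (reducedProj c) (bijective_reducedProj hc)
  contMDiff_toFun := (contMDiff_reducedMap (c.proj 0)).prodMk
    ((contMDiff_reducedMap (c.proj 1)).prodMk (contMDiff_reducedMap (c.proj 2)))
  contMDiff_invFun := by
    apply contMDiff_of_families
    intro k f₁ f₂ f₃ h₁ h₂ h₃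
    -- Along three families the inverse is the reduced map of their lift `u` to the product.
    obtain ⟨u, hu₁, hu₂, hu₃⟩ := exists_lift hc (ofContMDiff f₁ h₁) (ofContMDiff f₂ h₂)
      (ofContMDiff f₃ h₃)
    refine (contMDiff_toFun u).congr fun w => ?_
    refine (Equiv.symm_apply_eq _).mpr (Eq.symm ?_)
    rw [Equiv.ofBijective_apply, reducedProj_toFun, hu₁, hu₂, hu₃, toFun_ofContMDiff,
      toFun_ofContMDiff, toFun_ofContMDiff]

end LieSupersemiheap

theorem mainTheorem4 (S : Supermanifold) (A : LieSupersemiheap S) :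
    ∃ B : Semiheap S.Reduced,
      -- `B` is the reduced map of `μ`, and the only map with this property
      A.IsReducedMap B.op ∧ (∀ ρ, A.IsReducedMap ρ → ρ = B.op) ∧
      -- for every product `S⁽³⁾`, the reduced manifold of `S⁽³⁾` is `|S| × |S| × |S|`, and the
      -- reduced map of `μ : S⁽³⁾ ⟶ S` is `B`
      (∀ c : Limits.Fan fun _ : Fin 3 => S, Nonempty (Limits.IsLimit c) →
        ∃ Φ : Diffeomorph (𝓡 c.pt.evenDim)
            ((𝓡 S.evenDim).prod ((𝓡 S.evenDim).prod (𝓡 S.evenDim)))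
            c.pt.Reduced (S.Reduced × S.Reduced × S.Reduced) ∞,
          (∀ p, Φ p = LieSupersemiheap.reducedProj c p) ∧
          ∀ x y z, Supermanifold.reducedMap (A.mul c) (Φ.symm (x, y, z)) = B.op x y z) ∧
      IsLieSemiheap S.evenDim B ∧
      (A.IsSuperheap → IsLieHeap S.evenDim B) := by
  refine ⟨A.reducedSemiheap, A.isReducedMap_reducedOp,
    fun ρ hρ => hρ.eq A.isReducedMap_reducedOp, ?_, A.isLieSemiheap_reducedSemiheap,
    fun hA => ⟨A.isLieSemiheap_reducedSemiheap, A.isHeap_reducedSemiheap hA⟩⟩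
  rintro c ⟨hc⟩
  refine ⟨LieSupersemiheap.reducedProdDiffeomorph hc, fun _ => rfl, fun x y z => ?_⟩
  have h : LieSupersemiheap.reducedProj c
      ((LieSupersemiheap.reducedProdDiffeomorph hc).symm (x, y, z)) = (x, y, z) :=
    (LieSupersemiheap.reducedProdDiffeomorph hc).apply_symm_apply (x, y, z)
  -- `A.mul c` is the product of the projections, so the property of the reduced map is used at this
  -- universal triple.
  have h' := A.isReducedMap_reducedOp c.pt (c.proj 0) (c.proj 1) (c.proj 2)
    ((LieSupersemiheap.reducedProdDiffeomorph hc).symm (x, y, z))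
  rw [LieSupersemiheap.reducedProj, Prod.mk.injEq, Prod.mk.injEq] at h
  rw [h.1, h.2.1, h.2.2] at h'
  exact h'
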